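/- For $y\in\mathbb R$ let $\|y\|$ denote the distance from $y$ to the nearest integer. Let $(q_n)_{n\ge 1}$ be a real lacunary sequence, i.e. there is $r>1$ with $q_{n+1}/q_n\ge r$ for all $n\ge 1$. Then there exists a constant $C>0$, depending only on the sequence $(q_n)$, such that the following holds. Let $\mu$ be any probability measure on $[0,1)$ whose Fourier transform $\widehat\mu(t)=\int_0^1 e^{2\pi i t u}\,d\mu(u)$ satisfies $$\widehat\mu(t)=O\big((1+|t|)^{-\eta}\big)\qquad(|t|\to\infty)$$ for some $\eta>0$. Then for $\mu$-almost every $x\in[0,1)$ one has, for every $\delta\in[0,1)$ simultaneously, $$\|q_n x-\delta\|<\frac{C}{n}\qquad\text{for infinitely many } n\ge 1.$$ -/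

import Mathlib

open Filter MeasureTheory Asymptotics

/-- A real sequence `q 1, q 2, …` is lacunary if there is `r > 1` with
`q (n + 1) / q n ≥ r` for all `n ≥ 1` (the value `q 0` plays no role). Since `x / 0 = 0`, this
condition forces `q n ≠ 0` for all `n ≥ 1`. -/
def IsLacunary (q : ℕ → ℝ) : Prop :=
  ∃ r : ℝ, 1 < r ∧ ∀ n : ℕ, 1 ≤ n → r ≤ q (n + 1) / q n

/-- The Fourier transform `t ↦ ∫_{[0,1)} e(t u) dμ(u)`, where `e(x) = exp(2 π i x)`. -/
noncomputable def fourierTransformMeasure (μ : Measure ℝ) (t : ℝ) : ℂ :=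
  ∫ u in Set.Ico (0 : ℝ) 1, Complex.exp (2 * Real.pi * Complex.I * (t * u : ℝ)) ∂μ

/-- The distance from `x` to the nearest integer. -/
noncomputable def distNearestInt (x : ℝ) : ℝ := |x - round x|

/-!
The sequence has constant sign, and `‖-y‖ = ‖y‖`, so `q` may be taken positive. Cut the indices into
blocks `3 * 2 ^ j ≤ n < 4 * 2 ^ j`. Let `D` be a trigonometric polynomial of mean `1` and degree
`H = 2 ^ (j - a)` that is nonpositive outside the `2 / H`-neighbourhood of the integers and has
coefficients at most `5` (`exists_trigPolynomial_minorant`), and put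
`f = (1 - 2 ^ (-j) * ∑ D (q n * x - δ)) ^ 2`, the sum being over the block. If no `q n * x` of the
block is `2 / H`-close to `δ` modulo `1`, then `f x ≥ 1`. In expected value `f` is a normalised
variance: its low-frequency coefficients come from pairs with `l * q n + l' * q n'` nearly zero,
which by lacunarity are hardly more numerous than the diagonal ones, so they add up to
`O(2 ^ (-a)) ≤ 1 / 16` (`card_nearCancellation_le`, `exists_blockTest`). The integer `a`, and with it
the constant `C`, depends only on the lacunarity ratio.

The blocks are separated by gaps as long as themselves, so the product of the test functions of
the earlier blocks has frequencies much smaller than those of the next block. The high frequencies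
of the next `f` therefore stay high after multiplication and are killed by the decay of the
Fourier transform of `μ`, while its low frequencies are bounded in supremum norm by `1 / 16`; as
all the test functions are nonnegative, each block multiplies the integral by at most `1 / 16`
(`integral_mul_expSum_le`). Over the blocks `K ≤ j < 2 * K` this gives the bound `16 ^ (-K)` for the
measure of the `x` that miss `δ` in all of them (`measureReal_missed_le`). The accumulated error is a
weight `exp (O(K ^ 2))` times a power of `q (3 * 2 ^ K)`, hence of `r ^ 2 ^ K`, with negative
exponent, and is negligible however small `η` is.

There are `4 ^ K` targets `δ = i / 4 ^ K`, so the measures of the exceptional sets are summable over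
`K`, and Borel–Cantelli handles all targets at once (`ae_eventually_forall_grid`). An arbitrary `δ` is
within `4 ^ (-K) ≤ 2 ^ (-j)` of such a target, which is of the order `1 / n` allowed in block `j`.
-/

/-! ### The character `e` and a trigonometric minorant of a short interval -/

/-- The additive character `y ↦ e(y) = exp (2 π i y)`. -/
noncomputable def unitExp (y : ℝ) : ℂ := Complex.exp (2 * Real.pi * Complex.I * (y : ℝ))

lemma unitExp_add (x y : ℝ) : unitExp (x + y) = unitExp x * unitExp y := by
  simp only [unitExp, ← Complex.exp_add]
  congr 1
  push_cast
  ring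

@[simp] lemma unitExp_zero : unitExp 0 = 1 := by simp [unitExp]

lemma unitExp_eq_exp_mul_I (y : ℝ) :
    unitExp y = Complex.exp ((2 * Real.pi * y : ℝ) * Complex.I) := by
  simp only [unitExp]
  congr 1
  push_cast
  ring

@[simp] lemma norm_unitExp (y : ℝ) : ‖unitExp y‖ = 1 := by
  rw [unitExp_eq_exp_mul_I, Complex.norm_exp_ofReal_mul_I]

lemma conj_unitExp (y : ℝ) : (starRingEnd ℂ) (unitExp y) = unitExp (-y) := by
  rw [unitExp_eq_exp_mul_I, unitExp_eq_exp_mul_I, ← Complex.exp_conj,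
    map_mul, Complex.conj_ofReal, Complex.conj_I]
  congr 1
  push_cast
  ring

@[fun_prop] lemma continuous_unitExp : Continuous unitExp := by
  unfold unitExp
  fun_prop

lemma norm_one_sub_unitExp (y : ℝ) : ‖1 - unitExp y‖ = 2 * |Real.sin (Real.pi * y)| := by
  rw [norm_sub_rev, unitExp_eq_exp_mul_I, mul_comm, Complex.norm_exp_I_mul_ofReal_sub_one,
    norm_mul, Real.norm_eq_abs, Real.norm_eq_abs, abs_two]
  congr 3
  ring

lemma four_mul_distNearestInt_le (y : ℝ) : 4 * distNearestInt y ≤ ‖1 - unitExp y‖ := by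
  have hsin : |Real.sin (Real.pi * y)| = |Real.sin (Real.pi * (y - round y))| := by
    have : Real.pi * (y - round y) = Real.pi * y - (round y : ℤ) * Real.pi := by ring
    rw [this, Real.sin_sub_int_mul_pi, abs_mul, abs_zpow, abs_neg, abs_one, one_zpow, one_mul]
  have hpi := Real.pi_pos
  have habs : |Real.pi * (y - round y)| = Real.pi * distNearestInt y := by
    rw [abs_mul, abs_of_pos hpi, distNearestInt]
  have h := Real.mul_abs_le_abs_sin (x := Real.pi * (y - round y)) (by
    rw [habs]
    have := abs_sub_round y
    rw [distNearestInt]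
    nlinarith)
  rw [habs, ← mul_assoc, div_mul_cancel₀ _ hpi.ne'] at h
  rw [norm_one_sub_unitExp, hsin]
  linarith

lemma distNearestInt_neg (y : ℝ) : distNearestInt (-y) = distNearestInt y := by
  simp only [distNearestInt]
  apply le_antisymm
  · have := round_le (-y) (-round y)
    refine this.trans (le_of_eq ?_)
    rw [← abs_neg]
    push_cast
    congr 1
    ring
  · have := round_le y (-round (-y))
    refine this.trans (le_of_eq ?_)
    rw [← abs_neg]
    push_cast
    congr 1
    ring

lemma distNearestInt_add_le (x y : ℝ) : distNearestInt (x + y) ≤ distNearestInt x + |y| := by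
  simp only [distNearestInt]
  calc |x + y - round (x + y)| ≤ |x + y - round x| := round_le _ _
    _ = |(x - round x) + y| := by congr 1; ring
    _ ≤ _ := abs_add_le _ _

lemma normSq_sum_unitExp (u : ℕ → ℝ) (H : ℕ) (y : ℝ) :
    ((‖∑ h ∈ Finset.range H, (u h : ℂ) * unitExp (h * y)‖ ^ 2 : ℝ) : ℂ) =
      ∑ p ∈ Finset.range H ×ˢ Finset.range H,
        ((u p.1 * u p.2 : ℝ) : ℂ) * unitExp (((p.1 : ℤ) - (p.2 : ℤ) : ℤ) * y) := by
  rw [Complex.ofReal_pow, ← Complex.mul_conj', map_sum, Finset.sum_mul_sum, Finset.sum_product]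
  refine Finset.sum_congr rfl fun h _ => Finset.sum_congr rfl fun h' _ => ?_
  have : (((h : ℤ) - (h' : ℤ) : ℤ) : ℝ) * y = h * y + -(h' * y) := by push_cast; ring
  rw [this, unitExp_add, map_mul, conj_unitExp, Complex.conj_ofReal]
  push_cast
  ring

lemma sum_range_sq_mul_sub_sq (c : ℝ) (M : ℕ) :
    ∑ h ∈ Finset.range M, ((h : ℝ) * (c - h)) ^ 2 =
      c ^ 2 * ((M - 1) * M * (2 * M - 1) / 6) - 2 * c * ((M - 1) * M / 2) ^ 2 +
        (M - 1) * M * (2 * M - 1) * (3 * M ^ 2 - 3 * M - 1) / 30 := by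
  induction M with
  | zero => simp
  | succ M ih =>
    rw [Finset.sum_range_succ, ih]
    push_cast
    ring

/-- A trigonometric polynomial of degree at most `H` and mean `1` that is nonpositive outside the
`2 / H`-neighbourhood of the integers and whose coefficients are bounded independently of `H`.

It is a multiple of `|p|² (A - |1 - e(y)|²)`, where the coefficients of `p` are the parabola
`h (H - h) / H²`. As `(1 - e) p` has coefficients of size `1 / H`, the subtracted term is
dominated in mean by the first one, although both have coefficients of the same order. -/
lemma exists_trigPolynomial_minorant {H : ℕ} (hH : 2 ≤ H) :
    ∃ (a : ℤ → ℝ) (D : ℝ → ℝ),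
      (∀ y, (D y : ℂ) = 1 + ∑ l ∈ (Finset.Icc (-(H : ℤ)) H).erase 0, (a l : ℂ) * unitExp (l * y)) ∧
      (∀ l, |a l| ≤ 5) ∧ ∀ y, 0 < D y → distNearestInt y < 2 / H := by
  classical
  have hH0 : (0 : ℝ) < H := by positivity
  have hH2 : (2 : ℝ) ≤ H := by exact_mod_cast hH
  set s : ℕ → ℝ := fun h => h * (H - h) / H ^ 2 with hs
  set d : ℕ → ℝ := fun h => s (h + 1) - s h with hd
  set A : ℝ := 64 / H ^ 2 with hA
  set p : ℝ → ℂ := fun y => ∑ h ∈ Finset.range H, (s h : ℂ) * unitExp (h * y) with hp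
  set w : ℕ × ℕ → ℝ := fun x => A * (s x.1 * s x.2) - d x.1 * d x.2 with hw
  set b : ℤ → ℝ := fun l => ∑ x ∈ (Finset.range H ×ˢ Finset.range H) with
    ((x.1 : ℤ) - (x.2 : ℤ) = l), w x with hb
  set E : ℝ → ℝ := fun y => ‖p y‖ ^ 2 * (A - ‖1 - unitExp y‖ ^ 2) with hE
  have hs_bd : ∀ h < H, 0 ≤ s h ∧ s h ≤ 1 / 4 := by
    intro h hh
    have h1 : (h : ℝ) ≤ H := by exact_mod_cast hh.le
    refine ⟨by simp only [hs]; have := sub_nonneg.2 h1; positivity, ?_⟩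
    simp only [hs]
    rw [div_le_iff₀ (by positivity)]
    nlinarith [sq_nonneg ((H : ℝ) - 2 * h)]
  have hd_eq : ∀ h, d h = (H - 2 * h - 1) / H ^ 2 := by
    intro h
    simp only [hd, hs]
    push_cast
    ring
  have hd_bd : ∀ h < H, |d h| ≤ 1 / H := by
    intro h hh
    have h1 : (h : ℝ) + 1 ≤ H := by exact_mod_cast hh
    have h0 : (0 : ℝ) ≤ h := by positivity
    rw [hd_eq, abs_div, abs_of_pos (by positivity : (0 : ℝ) < (H : ℝ) ^ 2),
      div_le_div_iff₀ (by positivity) hH0]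
    have : |(H : ℝ) - 2 * h - 1| ≤ H := abs_le.2 ⟨by linarith, by linarith⟩
    nlinarith
  -- Summation by parts: `s 0 = s H = 0`, so multiplication by `1 - e` differences the coefficients.
  have hdiff : ∀ y, ‖(1 - unitExp y) * p y‖ =
      ‖∑ h ∈ Finset.range H, (d h : ℂ) * unitExp (h * y)‖ := by
    intro y
    have hshift : p y = unitExp y * ∑ h ∈ Finset.range H, (s (h + 1) : ℂ) * unitExp (h * y) := by
      have hs0 : s 0 = 0 := by simp [hs]
      have hsH : s H = 0 := by simp [hs]
      have : p y = ∑ h ∈ Finset.range (H + 1), (s h : ℂ) * unitExp (h * y) := by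
        rw [Finset.sum_range_succ, hsH]
        simp [hp]
      rw [this, Finset.sum_range_succ', hs0, Finset.mul_sum]
      simp only [Complex.ofReal_zero, zero_mul, add_zero]
      refine Finset.sum_congr rfl fun h _ => ?_
      rw [show ((h + 1 : ℕ) : ℝ) * y = y + h * y by push_cast; ring, unitExp_add]
      ring
    have : (1 - unitExp y) * p y =
        unitExp y * ∑ h ∈ Finset.range H, (d h : ℂ) * unitExp (h * y) := by
      rw [sub_mul, one_mul]
      nth_rewrite 1 [hshift]
      rw [← mul_sub, hp, ← Finset.sum_sub_distrib]
      congr 1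
      refine Finset.sum_congr rfl fun h _ => ?_
      simp only [hd]
      push_cast
      ring
    rw [this, norm_mul, norm_unitExp, one_mul]
  have hE_eq : ∀ y, (E y : ℂ) =
      ∑ l ∈ Finset.Icc (-(H : ℤ)) H, (b l : ℂ) * unitExp (l * y) := by
    intro y
    have h1 : E y = A * ‖p y‖ ^ 2 - ‖∑ h ∈ Finset.range H, (d h : ℂ) * unitExp (h * y)‖ ^ 2 := by
      rw [← hdiff, norm_mul]
      simp only [hE]
      ring
    rw [h1, Complex.ofReal_sub, Complex.ofReal_mul, hp, normSq_sum_unitExp, normSq_sum_unitExp,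
      Finset.mul_sum, ← Finset.sum_sub_distrib]
    have hmaps : ∀ x ∈ Finset.range H ×ˢ Finset.range H,
        (x.1 : ℤ) - (x.2 : ℤ) ∈ Finset.Icc (-(H : ℤ)) H := by
      intro x hx
      simp only [Finset.mem_product, Finset.mem_range] at hx
      rw [Finset.mem_Icc]
      omega
    rw [← Finset.sum_fiberwise_of_maps_to hmaps]
    refine Finset.sum_congr rfl fun l _ => ?_
    simp only [hb]
    rw [Complex.ofReal_sum, Finset.sum_mul]
    refine Finset.sum_congr rfl fun x hx => ?_
    rw [(Finset.mem_filter.1 hx).2]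
    simp only [hw]
    push_cast
    ring
  have hb_bd : ∀ l, |b l| ≤ 5 / H := by
    intro l
    have hterm : ∀ x ∈ (Finset.range H ×ˢ Finset.range H).filter
        (fun x => (x.1 : ℤ) - (x.2 : ℤ) = l), |w x| ≤ 5 / H ^ 2 := by
      intro x hx
      simp only [Finset.mem_filter, Finset.mem_product, Finset.mem_range] at hx
      obtain ⟨⟨h1, h2⟩, -⟩ := hx
      have e1 : |A * (s x.1 * s x.2)| ≤ 4 / H ^ 2 := by
        have p1 := hs_bd _ h1
        have p2 := hs_bd _ h2
        have hA0 : 0 < A := by positivity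
        rw [abs_of_nonneg (by have := p1.1; have := p2.1; positivity)]
        have : s x.1 * s x.2 ≤ 1 / 4 * (1 / 4) := mul_le_mul p1.2 p2.2 p2.1 (by norm_num)
        calc A * (s x.1 * s x.2) ≤ A * (1 / 4 * (1 / 4)) := by gcongr
          _ = 4 / H ^ 2 := by rw [hA]; ring
      have e2 : |d x.1 * d x.2| ≤ 1 / H ^ 2 := by
        rw [abs_mul]
        calc |d x.1| * |d x.2| ≤ 1 / H * (1 / H) :=
              mul_le_mul (hd_bd _ h1) (hd_bd _ h2) (abs_nonneg _) (by positivity)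
          _ = 1 / H ^ 2 := by ring
      calc |w x| ≤ |A * (s x.1 * s x.2)| + |d x.1 * d x.2| := abs_sub _ _
        _ ≤ 4 / H ^ 2 + 1 / H ^ 2 := add_le_add e1 e2
        _ = 5 / H ^ 2 := by ring
    have hcard : ((Finset.range H ×ˢ Finset.range H).filter
        (fun x => (x.1 : ℤ) - (x.2 : ℤ) = l)).card ≤ H := by
      conv_rhs => rw [← Finset.card_range H]
      refine Finset.card_le_card_of_injOn Prod.fst ?_ ?_
      · intro x hx
        simp only [Finset.coe_filter, Finset.mem_product, Set.mem_ofPred_eq] at hx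
        exact hx.1.1
      · intro x hx x' hx' hxx
        simp only [Finset.coe_filter, Set.mem_ofPred_eq] at hx hx'
        have := hx.2
        have := hx'.2
        ext <;> grind
    calc |b l| ≤ ∑ x ∈ (Finset.range H ×ˢ Finset.range H).filter
          (fun x => (x.1 : ℤ) - (x.2 : ℤ) = l), |w x| := Finset.abs_sum_le_sum_abs _ _
      _ ≤ _ := Finset.sum_le_card_nsmul _ _ _ hterm
      _ ≤ H * (5 / H ^ 2) := by
        rw [nsmul_eq_mul]
        gcongr
      _ = 5 / H := by field_simp
  have hb0 : 1 / H ≤ b 0 := by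
    have hb0_eq : b 0 = ∑ h ∈ Finset.range H, w (h, h) := by
      simp only [hb]
      symm
      refine Finset.sum_bij (fun h _ => (h, h)) ?_ ?_ ?_ ?_
      · intro h hh
        simpa using hh
      · intro h _ h' _ hh
        exact (Prod.mk.inj hh).1
      · rintro ⟨h, h'⟩ hx
        simp only [Finset.mem_filter, Finset.mem_product] at hx
        exact ⟨h, hx.1.1, by ext <;> grind⟩
      · intros; rfl
    have hsq : ∑ h ∈ Finset.range H, s h ^ 2 = ((H : ℝ) ^ 4 - 1) / (30 * H ^ 3) := by
      have : ∀ h ∈ Finset.range H, s h ^ 2 = ((h : ℝ) * (H - h)) ^ 2 * (1 / H ^ 4) := by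
        intro h _
        simp only [hs]
        field_simp
      rw [Finset.sum_congr rfl this, ← Finset.sum_mul, sum_range_sq_mul_sub_sq]
      field_simp
      ring
    have hsd : ∑ h ∈ Finset.range H, d h ^ 2 ≤ 1 / H := by
      calc ∑ h ∈ Finset.range H, d h ^ 2 ≤ ∑ h ∈ Finset.range H, (1 / (H : ℝ)) ^ 2 := by
            refine Finset.sum_le_sum fun h hh => ?_
            rw [← sq_abs]
            have := hd_bd h (Finset.mem_range.1 hh)
            gcongr
        _ = 1 / H := by
          rw [Finset.sum_const, Finset.card_range, nsmul_eq_mul]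
          field_simp
    have : b 0 = A * ∑ h ∈ Finset.range H, s h ^ 2 - ∑ h ∈ Finset.range H, d h ^ 2 := by
      rw [hb0_eq, Finset.mul_sum, ← Finset.sum_sub_distrib]
      refine Finset.sum_congr rfl fun h _ => ?_
      simp only [hw]
      ring
    -- The constant `64` in `A` makes the main term of the mean twice the subtracted one.
    have hmain : 2 / H ≤ A * (((H : ℝ) ^ 4 - 1) / (30 * H ^ 3)) := by
      have h4 : (16 : ℝ) ≤ H ^ 4 := by
        calc (16 : ℝ) = 2 ^ 4 := by norm_num
          _ ≤ H ^ 4 := by gcongr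
      rw [hA, div_mul_div_comm, div_le_div_iff₀ hH0 (by positivity)]
      have : 0 ≤ (H : ℝ) * (H ^ 4 - 16) := mul_nonneg hH0.le (by linarith)
      nlinarith
    rw [this, hsq]
    have : (2 : ℝ) / H = 1 / H + 1 / H := by ring
    linarith
  have hb0_pos : 0 < b 0 := lt_of_lt_of_le (by positivity) hb0
  refine ⟨fun l => b l / b 0, fun y => E y / b 0, ?_, ?_, ?_⟩
  · intro y
    have h0 : (0 : ℤ) ∈ Finset.Icc (-(H : ℤ)) H := by simp
    have hne : (b 0 : ℂ) ≠ 0 := by exact_mod_cast hb0_pos.ne'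
    rw [Complex.ofReal_div, hE_eq, ← Finset.add_sum_erase _ _ h0, add_div, Finset.sum_div]
    congr 1
    · simp [hne]
    · refine Finset.sum_congr rfl fun l _ => ?_
      push_cast
      ring
  · intro l
    simp only
    rw [abs_div, abs_of_pos hb0_pos, div_le_iff₀ hb0_pos]
    calc |b l| ≤ 5 / H := hb_bd l
      _ = 5 * (1 / H) := by ring
      _ ≤ 5 * b 0 := by gcongr
  · intro y hy
    have hEy : 0 < E y := by
      rcases div_pos_iff.1 hy with h | h
      · exact h.1
      · exact absurd h.2 (not_lt.2 hb0_pos.le)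
    have h1 : ‖1 - unitExp y‖ ^ 2 < (8 / H) ^ 2 := by
      have : 0 < A - ‖1 - unitExp y‖ ^ 2 := pos_of_mul_pos_right hEy (by positivity)
      have hA' : A = (8 / H) ^ 2 := by rw [hA]; ring
      linarith
    have h2 := lt_of_pow_lt_pow_left₀ 2 (by positivity) h1
    have h3 := four_mul_distNearestInt_le y
    have : (8 : ℝ) / H = 4 * (2 / H) := by ring
    linarith

/-! ### Exponential sums and decorrelation -/

/-- `HasExpSum f S c t` means that `f` is the exponential sum `∑ i ∈ S, c i * e(t i * x)`. -/
def HasExpSum {ι : Type} (f : ℝ → ℝ) (S : Finset ι) (c : ι → ℂ) (t : ι → ℝ) : Prop :=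
  ∀ x, (f x : ℂ) = ∑ i ∈ S, c i * unitExp (t i * x)

/-- `f` is an exponential sum with real frequencies of modulus at most `T` whose coefficients
have absolute sum at most `W`. -/
def IsExpSum (f : ℝ → ℝ) (W T : ℝ) : Prop :=
  ∃ (ι : Type) (S : Finset ι) (c : ι → ℂ) (t : ι → ℝ),
    HasExpSum f S c t ∧ ∑ i ∈ S, ‖c i‖ ≤ W ∧ ∀ i ∈ S, |t i| ≤ T

lemma HasExpSum.mul {ι κ : Type} {f g : ℝ → ℝ} {S : Finset ι} {c : ι → ℂ} {t : ι → ℝ}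
    {S' : Finset κ} {c' : κ → ℂ} {t' : κ → ℝ} (hf : HasExpSum f S c t)
    (hg : HasExpSum g S' c' t') :
    HasExpSum (fun x => f x * g x) (S ×ˢ S') (fun i => c i.1 * c' i.2)
      (fun i => t i.1 + t' i.2) := by
  intro x
  rw [Complex.ofReal_mul, hf x, hg x, Finset.sum_mul_sum, Finset.sum_product]
  refine Finset.sum_congr rfl fun i _ => Finset.sum_congr rfl fun j _ => ?_
  rw [add_mul, unitExp_add]
  ring

lemma IsExpSum.mul {f g : ℝ → ℝ} {W T W' T' : ℝ} (hf : IsExpSum f W T) (hg : IsExpSum g W' T') :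
    IsExpSum (fun x => f x * g x) (W * W') (T + T') := by
  obtain ⟨ι, S, c, t, h, hW, hT⟩ := hf
  obtain ⟨κ, S', c', t', h', hW', hT'⟩ := hg
  refine ⟨ι × κ, S ×ˢ S', _, _, h.mul h', ?_, ?_⟩
  · simp only [norm_mul, Finset.sum_product]
    rw [← Finset.sum_mul_sum]
    have : 0 ≤ ∑ i ∈ S, ‖c i‖ := Finset.sum_nonneg fun _ _ => norm_nonneg _
    exact mul_le_mul hW hW' (Finset.sum_nonneg fun _ _ => norm_nonneg _) (this.trans hW)
  · intro i hi
    rw [Finset.mem_product] at hi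
    exact (abs_add_le _ _).trans (add_le_add (hT _ hi.1) (hT' _ hi.2))

lemma isExpSum_one : IsExpSum (fun _ => 1) 1 0 :=
  ⟨Unit, Finset.univ, fun _ => 1, fun _ => 0, fun x => by simp, by simp, by simp⟩

lemma IsExpSum.mono {f : ℝ → ℝ} {W T W' T' : ℝ} (hf : IsExpSum f W T) (hW : W ≤ W')
    (hT : T ≤ T') : IsExpSum f W' T' := by
  obtain ⟨ι, S, c, t, h, h1, h2⟩ := hf
  exact ⟨ι, S, c, t, h, h1.trans hW, fun i hi => (h2 i hi).trans hT⟩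

lemma HasExpSum.continuous {ι : Type} {f : ℝ → ℝ} {S : Finset ι} {c : ι → ℂ} {t : ι → ℝ}
    (hf : HasExpSum f S c t) : Continuous f := by
  have : f = fun x => (∑ i ∈ S, c i * unitExp (t i * x)).re := by
    ext x
    rw [← hf x, Complex.ofReal_re]
  rw [this]
  fun_prop

lemma HasExpSum.abs_le {ι : Type} {f : ℝ → ℝ} {S : Finset ι} {c : ι → ℂ} {t : ι → ℝ}
    (hf : HasExpSum f S c t) (x : ℝ) : |f x| ≤ ∑ i ∈ S, ‖c i‖ := by
  rw [← Real.norm_eq_abs, ← Complex.norm_real, hf x]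
  refine (norm_sum_le _ _).trans (le_of_eq ?_)
  simp

lemma HasExpSum.integrable {ι : Type} {f : ℝ → ℝ} {S : Finset ι} {c : ι → ℂ} {t : ι → ℝ}
    (hf : HasExpSum f S c t) (μ : Measure ℝ) [IsFiniteMeasure μ] : Integrable f μ :=
  Integrable.of_bound hf.continuous.aestronglyMeasurable _ (ae_of_all _ hf.abs_le)

lemma IsExpSum.integrable {f : ℝ → ℝ} {W T : ℝ} (hf : IsExpSum f W T) (μ : Measure ℝ)
    [IsFiniteMeasure μ] : Integrable f μ := by
  obtain ⟨ι, S, c, t, h, -, -⟩ := hf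
  exact h.integrable μ

lemma integrable_unitExp_mul (μ : Measure ℝ) [IsFiniteMeasure μ] (t : ℝ) :
    Integrable (fun x => unitExp (t * x)) μ :=
  Integrable.of_bound (C := 1) (by fun_prop) (ae_of_all _ fun x => by simp)

/-- Decorrelation: a nonnegative exponential sum `f` with frequencies at most `T` is multiplied by
an exponential sum `g`. The frequencies of `g` above `2 * T` produce frequencies above `T` in the
product, where the Fourier transform of `μ` is at most `ε`; the low frequencies of `g` are bounded
in supremum norm by the sum of their coefficients, which is where `0 ≤ f` is needed. -/
lemma integral_mul_expSum_le {ι : Type} {μ : Measure ℝ} [IsFiniteMeasure μ] {f g : ℝ → ℝ}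
    {S : Finset ι} {c : ι → ℂ} {t : ι → ℝ} {W W' T s ε : ℝ} (hf : IsExpSum f W T)
    (hf0 : ∀ x, 0 ≤ f x) (hg : HasExpSum g S c t) (hW' : ∑ i ∈ S, ‖c i‖ ≤ W')
    (hs : ∑ i ∈ S with |t i| < 2 * T, ‖c i‖ ≤ s)
    (hε : ∀ u, T ≤ |u| → ‖∫ x, unitExp (u * x) ∂μ‖ ≤ ε) (hε0 : 0 ≤ ε) :
    ∫ x, f x * g x ∂μ ≤ s * ∫ x, f x ∂μ + W * W' * ε := by
  have hfi := hf.integrable μ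
  obtain ⟨κ, R, d, v, hfR, hW, hT⟩ := hf
  have hW0 : 0 ≤ W := (Finset.sum_nonneg fun _ _ => norm_nonneg _).trans hW
  have hfint : ∀ u, Integrable (fun x => (f x : ℂ) * unitExp (u * x)) μ := by
    intro u
    refine (hfi.ofReal (𝕜 := ℂ)).mul_bdd (c := 1) (by fun_prop) (ae_of_all _ fun x => by simp)
  have hsum : ((∫ x, f x * g x ∂μ : ℝ) : ℂ) =
      ∑ i ∈ S, c i * ∫ x, (f x : ℂ) * unitExp (t i * x) ∂μ := by
    rw [← integral_complex_ofReal]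
    have : ∀ x, ((f x * g x : ℝ) : ℂ) = ∑ i ∈ S, c i * ((f x : ℂ) * unitExp (t i * x)) := by
      intro x
      rw [Complex.ofReal_mul, hg x, Finset.mul_sum]
      refine Finset.sum_congr rfl fun i _ => ?_
      ring
    simp_rw [this]
    rw [integral_finsetSum _ fun i _ => (hfint (t i)).const_mul _]
    simp_rw [integral_const_mul]
  have hlow : ∀ u, ‖∫ x, (f x : ℂ) * unitExp (u * x) ∂μ‖ ≤ ∫ x, f x ∂μ := by
    intro u
    refine (norm_integral_le_integral_norm _).trans (le_of_eq ?_)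
    refine integral_congr_ae (ae_of_all _ fun x => ?_)
    simp [abs_of_nonneg (hf0 x)]
  have hhigh : ∀ u, 2 * T ≤ |u| → ‖∫ x, (f x : ℂ) * unitExp (u * x) ∂μ‖ ≤ W * ε := by
    intro u hu
    have : ∀ x, (f x : ℂ) * unitExp (u * x) = ∑ j ∈ R, d j * unitExp ((v j + u) * x) := by
      intro x
      rw [hfR x, Finset.sum_mul]
      refine Finset.sum_congr rfl fun j _ => ?_
      rw [add_mul, unitExp_add, mul_assoc]
    simp_rw [this]
    rw [integral_finsetSum _ fun j _ => (integrable_unitExp_mul μ _).const_mul _]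
    simp_rw [integral_const_mul]
    calc ‖∑ j ∈ R, d j * ∫ x, unitExp ((v j + u) * x) ∂μ‖
        ≤ ∑ j ∈ R, ‖d j * ∫ x, unitExp ((v j + u) * x) ∂μ‖ := norm_sum_le _ _
      _ ≤ ∑ j ∈ R, ‖d j‖ * ε := by
        refine Finset.sum_le_sum fun j hj => ?_
        rw [norm_mul]
        refine mul_le_mul_of_nonneg_left (hε _ ?_) (norm_nonneg _)
        have h1 := hT j hj
        have h2 := abs_sub_abs_le_abs_sub u (-v j)
        rw [abs_neg, sub_neg_eq_add, add_comm u] at h2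
        linarith
      _ ≤ W * ε := by
        rw [← Finset.sum_mul]
        gcongr
  have hI0 : 0 ≤ ∫ x, f x ∂μ := integral_nonneg hf0
  calc ∫ x, f x * g x ∂μ ≤ ‖((∫ x, f x * g x ∂μ : ℝ) : ℂ)‖ := by
        rw [Complex.norm_real]
        exact le_abs_self _
    _ ≤ ∑ i ∈ S, ‖c i‖ * ‖∫ x, (f x : ℂ) * unitExp (t i * x) ∂μ‖ := by
        rw [hsum]
        refine (norm_sum_le _ _).trans (le_of_eq ?_)
        simp
    _ = (∑ i ∈ S with |t i| < 2 * T, ‖c i‖ * ‖∫ x, (f x : ℂ) * unitExp (t i * x) ∂μ‖) +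
        ∑ i ∈ S with ¬ |t i| < 2 * T, ‖c i‖ * ‖∫ x, (f x : ℂ) * unitExp (t i * x) ∂μ‖ :=
        (Finset.sum_filter_add_sum_filter_not _ _ _).symm
    _ ≤ (∑ i ∈ S with |t i| < 2 * T, ‖c i‖ * ∫ x, f x ∂μ) +
        ∑ i ∈ S with ¬ |t i| < 2 * T, ‖c i‖ * (W * ε) := by
        refine add_le_add (Finset.sum_le_sum fun i _ => ?_) (Finset.sum_le_sum fun i hi => ?_)
        · exact mul_le_mul_of_nonneg_left (hlow _) (norm_nonneg _)
        · exact mul_le_mul_of_nonneg_left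
            (hhigh _ (not_lt.1 (Finset.mem_filter.1 hi).2)) (norm_nonneg _)
    _ ≤ s * ∫ x, f x ∂μ + W * W' * ε := by
        rw [← Finset.sum_mul, ← Finset.sum_mul]
        refine add_le_add (mul_le_mul_of_nonneg_right hs hI0) ?_
        have h1 : ∑ i ∈ S with ¬ |t i| < 2 * T, ‖c i‖ ≤ W' :=
          (Finset.sum_le_sum_of_subset_of_nonneg (Finset.filter_subset _ _)
            fun _ _ _ => norm_nonneg _).trans hW'
        calc _ ≤ W' * (W * ε) := mul_le_mul_of_nonneg_right h1 (by positivity)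
          _ = W * W' * ε := by ring

/-! ### Lacunary sequences: near-cancellations and test functions of blocks -/

lemma pow_mul_le_of_lacunary {q : ℕ → ℝ} {r : ℝ} (hr : 1 < r)
    (hlac : ∀ n, 1 ≤ n → r * q n ≤ q (n + 1)) {m n : ℕ} (hm : 1 ≤ m) (hmn : m ≤ n) :
    r ^ (n - m) * q m ≤ q n := by
  induction n, hmn using Nat.le_induction with
  | base => simp
  | succ n hmn ih =>
    rw [Nat.succ_sub hmn, pow_succ']
    calc r * r ^ (n - m) * q m = r * (r ^ (n - m) * q m) := by ring
      _ ≤ r * q n := by gcongr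
      _ ≤ q (n + 1) := hlac n (hm.trans hmn)

/-- If `τ ≤ x / 2`, then `l * x + l' * y` is less than `τ` in modulus for at most `4 H x / y` pairs
of nonzero integers of modulus at most `H`: `l'` determines `l`, and `|l'| ≤ 2 H x / y`. -/
lemma card_pairs_abs_lt {H : ℕ} (hH : 1 ≤ H) {x y τ : ℝ} (hx : 0 < x) (hy : 0 < y)
    (hτ : τ ≤ x / 2) :
    ((((Finset.Icc (-(H : ℤ)) H).erase 0 ×ˢ (Finset.Icc (-(H : ℤ)) H).erase 0).filter
      (fun p : ℤ × ℤ => |p.1 * x + p.2 * y| < τ)).card : ℝ) ≤ 4 * H * (x / y) := by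
  have hH1 : (1 : ℝ) ≤ H := by exact_mod_cast hH
  set M : ℤ := ⌊2 * H * (x / y)⌋ with hM
  have hM0 : 0 ≤ M := Int.floor_nonneg.2 (by positivity)
  have hcard : (((Finset.Icc (-(H : ℤ)) H).erase 0 ×ˢ (Finset.Icc (-(H : ℤ)) H).erase 0).filter
      (fun p : ℤ × ℤ => |p.1 * x + p.2 * y| < τ)).card ≤ ((Finset.Icc (-M) M).erase 0).card := by
    refine Finset.card_le_card_of_injOn Prod.snd ?_ ?_
    · rintro ⟨l, l'⟩ hp
      simp only [Finset.coe_filter, Finset.mem_product, Finset.mem_erase, Finset.mem_Icc,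
        Set.mem_ofPred_eq] at hp
      obtain ⟨⟨⟨-, h1, h2⟩, h3, -⟩, h4⟩ := hp
      have hl : |(l : ℝ)| ≤ H := by
        rw [abs_le]
        exact ⟨by exact_mod_cast h1, by exact_mod_cast h2⟩
      have hl' : |(l' : ℝ)| * y ≤ 2 * H * x := by
        have e1 := abs_sub_abs_le_abs_sub (l' * y) (-(l * x))
        rw [abs_neg, sub_neg_eq_add, add_comm (l' * y : ℝ), abs_mul, abs_mul,
          abs_of_pos hx, abs_of_pos hy] at e1
        have e2 : |(l : ℝ)| * x ≤ H * x := by gcongr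
        have e3 : 1 * x ≤ H * x := by gcongr
        linarith
      have hl'' : |(l' : ℝ)| ≤ 2 * H * (x / y) := by
        rw [← mul_div_assoc, le_div_iff₀ hy]
        exact hl'
      have hfl : |l'| ≤ M := Int.le_floor.2 (by push_cast; exact hl'')
      simp only [Finset.coe_erase, Finset.coe_Icc, Set.mem_sdiff, Set.mem_Icc,
        Set.mem_singleton_iff]
      exact ⟨abs_le.1 hfl, h3⟩
    · rintro ⟨l, l'⟩ hp ⟨k, k'⟩ hp' (rfl : l' = k')
      simp only [Finset.coe_filter, Set.mem_ofPred_eq] at hp hp'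
      have h1 := abs_lt.1 hp.2
      have h2 := abs_lt.1 hp'.2
      have h3 : |((l - k : ℤ) : ℝ)| < 1 := by
        have : |((l - k : ℤ) : ℝ)| * x < 1 * x := by
          rw [← abs_of_pos hx, ← abs_mul, abs_of_pos hx, abs_lt]
          push_cast
          constructor <;> linarith
        exact lt_of_mul_lt_mul_right this hx.le
      have h4 : |l - k| < 1 := by exact_mod_cast h3
      rw [Int.abs_lt_one_iff] at h4
      ext
      · exact sub_eq_zero.1 h4
      · rfl
  have hM2 : (((Finset.Icc (-M) M).erase 0).card : ℝ) = 2 * M := by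
    rw [Finset.card_erase_of_mem (by simp [hM0]), Int.card_Icc]
    have : (((M + 1 - -M).toNat - 1 : ℕ) : ℤ) = 2 * M := by omega
    exact_mod_cast this
  calc _ ≤ (((Finset.Icc (-M) M).erase 0).card : ℝ) := by exact_mod_cast hcard
    _ = 2 * M := hM2
    _ ≤ 2 * (2 * H * (x / y)) := by
      have := Int.floor_le (2 * H * (x / y))
      gcongr
    _ = 4 * H * (x / y) := by ring

lemma sum_pow_le_of_injOn {F : Finset ℕ} {g : ℕ → ℕ} (hg : Set.InjOn g F) {ρ : ℝ} (h0 : 0 ≤ ρ)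
    (h1 : ρ < 1) : ∑ n ∈ F, ρ ^ g n ≤ (1 - ρ)⁻¹ := by
  rw [← Finset.sum_image (f := fun i => ρ ^ i) hg, ← tsum_geometric_of_lt_one h0 h1]
  exact (summable_geometric_of_lt_one h0 h1).sum_le_tsum _ fun i _ => by positivity

lemma sum_pow_natDist_le (F : Finset ℕ) (n : ℕ) {ρ : ℝ} (h0 : 0 ≤ ρ) (h1 : ρ < 1) :
    ∑ n' ∈ F, ρ ^ Nat.dist n n' ≤ 2 * (1 - ρ)⁻¹ := by
  rw [← Finset.sum_filter_add_sum_filter_not F (fun n' => n ≤ n'), two_mul]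
  refine add_le_add (sum_pow_le_of_injOn ?_ h0 h1) (sum_pow_le_of_injOn ?_ h0 h1) <;>
  · intro x hx y hy hxy
    simp only [Finset.coe_filter, Set.mem_ofPred_eq, Nat.dist] at hx hy hxy
    omega

/-- For a lacunary sequence, near-cancellations `|l * q n + l' * q n'| < τ` with
`0 < |l|, |l'| ≤ H` and `n, n'` in an interval are as rare as the diagonal ones
`n = n'`, `l' = -l`, up to a constant. -/
lemma card_nearCancellation_le {q : ℕ → ℝ} {r : ℝ} (hr : 1 < r) (hq : ∀ n, 1 ≤ n → 0 < q n)
    (hlac : ∀ n, 1 ≤ n → r * q n ≤ q (n + 1)) {A B H : ℕ} (hA : 1 ≤ A) (hH : 1 ≤ H) {τ : ℝ}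
    (hτ : τ ≤ q A / 2) :
    (((((Finset.Ico A B) ×ˢ (Finset.Icc (-(H : ℤ)) H).erase 0) ×ˢ
      ((Finset.Ico A B) ×ˢ (Finset.Icc (-(H : ℤ)) H).erase 0)).filter
      (fun i : (ℕ × ℤ) × (ℕ × ℤ) => |i.1.2 * q i.1.1 + i.2.2 * q i.2.1| < τ)).card : ℝ) ≤
      8 * ((B - A : ℕ) : ℝ) * H * (1 - r⁻¹)⁻¹ := by
  classical
  set L := (Finset.Icc (-(H : ℤ)) H).erase 0 with hL
  set I := ((Finset.Ico A B ×ˢ L) ×ˢ (Finset.Ico A B ×ˢ L)).filter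
      (fun i : (ℕ × ℤ) × (ℕ × ℤ) => |i.1.2 * q i.1.1 + i.2.2 * q i.2.1| < τ) with hI
  have hr0 : 0 < r := by linarith
  have hmono : ∀ m n, 1 ≤ m → m ≤ n → q m / q n ≤ r⁻¹ ^ (n - m) := by
    intro m n hm hmn
    rw [div_le_iff₀ (hq n (hm.trans hmn)), inv_pow, ← div_eq_inv_mul, le_div_iff₀ (by positivity),
      mul_comm]
    exact pow_mul_le_of_lacunary hr hlac hm hmn
  have hqA : ∀ n ∈ Finset.Ico A B, 1 ≤ n ∧ τ ≤ q n / 2 := by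
    intro n hn
    rw [Finset.mem_Ico] at hn
    refine ⟨hA.trans hn.1, hτ.trans ?_⟩
    have h1 := pow_mul_le_of_lacunary hr hlac hA hn.1
    have h2 : 1 * q A ≤ r ^ (n - A) * q A := by
      have := hq A hA
      gcongr
      exact one_le_pow₀ hr.le
    linarith
  have hmaps : ∀ i ∈ I, (i.1.1, i.2.1) ∈ Finset.Ico A B ×ˢ Finset.Ico A B := by
    intro i hi
    simp only [hI, Finset.mem_filter, Finset.mem_product] at hi
    exact Finset.mk_mem_product hi.1.1.1 hi.1.2.1
  have hfib : ∀ p ∈ Finset.Ico A B ×ˢ Finset.Ico A B,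
      (({i ∈ I | (i.1.1, i.2.1) = p}.card : ℕ) : ℝ) ≤ 4 * H * r⁻¹ ^ Nat.dist p.1 p.2 := by
    rintro ⟨n, n'⟩ hp
    obtain ⟨hn, hn'⟩ := Finset.mem_product.1 hp
    obtain ⟨hn1, hnτ⟩ := hqA _ hn
    obtain ⟨hn1', hnτ'⟩ := hqA _ hn'
    simp only at hn1 hnτ hn1' hnτ' ⊢
    rcases le_total n n' with h | h
    · have hc : {i ∈ I | (i.1.1, i.2.1) = (n, n')}.card ≤
          ((L ×ˢ L).filter (fun p : ℤ × ℤ => |p.1 * q n + p.2 * q n'| < τ)).card := by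
        refine Finset.card_le_card_of_injOn (fun i => (i.1.2, i.2.2)) ?_ ?_
        · rintro ⟨⟨m, l⟩, m', l'⟩ hi
          simp only [hI, Finset.coe_filter, Finset.mem_filter, Finset.mem_product,
            Set.mem_ofPred_eq, Prod.mk.injEq] at hi ⊢
          obtain ⟨⟨h1, h2⟩, rfl, rfl⟩ := hi
          exact ⟨⟨h1.1.2, h1.2.2⟩, h2⟩
        · rintro ⟨⟨m, l⟩, m', l'⟩ hi ⟨⟨k, j⟩, k', j'⟩ hi' he
          simp only [Finset.coe_filter, Set.mem_ofPred_eq, Prod.mk.injEq] at hi hi' he ⊢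
          grind
      calc _ ≤ (((L ×ˢ L).filter (fun p : ℤ × ℤ => |p.1 * q n + p.2 * q n'| < τ)).card : ℝ) := by
            exact_mod_cast hc
        _ ≤ 4 * H * (q n / q n') := card_pairs_abs_lt hH (hq n hn1) (hq n' hn1') hnτ
        _ ≤ 4 * H * r⁻¹ ^ Nat.dist n n' := by
          rw [Nat.dist_eq_sub_of_le h]
          have := hmono n n' hn1 h
          gcongr
    · -- The roles of the two frequencies are exchanged, so that the smaller one comes first.
      have hc : {i ∈ I | (i.1.1, i.2.1) = (n, n')}.card ≤
          ((L ×ˢ L).filter (fun p : ℤ × ℤ => |p.1 * q n' + p.2 * q n| < τ)).card := by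
        refine Finset.card_le_card_of_injOn (fun i => (i.2.2, i.1.2)) ?_ ?_
        · rintro ⟨⟨m, l⟩, m', l'⟩ hi
          simp only [hI, Finset.coe_filter, Finset.mem_filter, Finset.mem_product,
            Set.mem_ofPred_eq, Prod.mk.injEq] at hi ⊢
          obtain ⟨⟨h1, h2⟩, rfl, rfl⟩ := hi
          rw [add_comm] at h2
          exact ⟨⟨h1.2.2, h1.1.2⟩, h2⟩
        · rintro ⟨⟨m, l⟩, m', l'⟩ hi ⟨⟨k, j⟩, k', j'⟩ hi' he
          simp only [Finset.coe_filter, Set.mem_ofPred_eq, Prod.mk.injEq] at hi hi' he ⊢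
          grind
      calc _ ≤ (((L ×ˢ L).filter (fun p : ℤ × ℤ => |p.1 * q n' + p.2 * q n| < τ)).card : ℝ) := by
            exact_mod_cast hc
        _ ≤ 4 * H * (q n' / q n) := card_pairs_abs_lt hH (hq n' hn1') (hq n hn1) hnτ'
        _ ≤ 4 * H * r⁻¹ ^ Nat.dist n n' := by
          rw [Nat.dist_eq_sub_of_le_right h]
          have := hmono n' n hn1' h
          gcongr
  calc (I.card : ℝ) = ∑ p ∈ Finset.Ico A B ×ˢ Finset.Ico A B,
        (({i ∈ I | (i.1.1, i.2.1) = p}.card : ℕ) : ℝ) := by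
        rw [Finset.card_eq_sum_card_fiberwise hmaps]
        push_cast
        rfl
    _ ≤ ∑ p ∈ Finset.Ico A B ×ˢ Finset.Ico A B, 4 * H * r⁻¹ ^ Nat.dist p.1 p.2 :=
        Finset.sum_le_sum hfib
    _ = ∑ n ∈ Finset.Ico A B, 4 * H * ∑ n' ∈ Finset.Ico A B, r⁻¹ ^ Nat.dist n n' := by
        rw [Finset.sum_product]
        simp_rw [Finset.mul_sum]
    _ ≤ ∑ n ∈ Finset.Ico A B, 4 * H * (2 * (1 - r⁻¹)⁻¹) := by
        refine Finset.sum_le_sum fun n _ => ?_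
        have := sum_pow_natDist_le (Finset.Ico A B) n (ρ := r⁻¹) (by positivity)
          (inv_lt_one_of_one_lt₀ hr)
        gcongr
    _ = 8 * ((B - A : ℕ) : ℝ) * H * (1 - r⁻¹)⁻¹ := by
        rw [Finset.sum_const, Nat.card_Ico, nsmul_eq_mul]
        ring

/-- The test function of one block of indices `A ≤ n < B`: the square of
`1 - (B - A)⁻¹ ∑ D (q n * x - δ)`, where `D` is the minorant of degree `H`. It is at least `1` when
no `q n * x` of the block comes within `2 / H` of `δ` modulo `1`. As `D` has mean `1`, the constant
terms cancel, so its low frequencies come only from near-cancellations between two terms, and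
their total weight is of order `H / (B - A)`. -/
lemma exists_blockTest {q : ℕ → ℝ} {r : ℝ} (hr : 1 < r) (hq : ∀ n, 1 ≤ n → 0 < q n)
    (hlac : ∀ n, 1 ≤ n → r * q n ≤ q (n + 1)) {A B H : ℕ} (hA : 1 ≤ A) (hAB : A < B)
    (hH : 2 ≤ H) (δ : ℝ) :
    ∃ (f : ℝ → ℝ) (ι : Type) (S : Finset ι) (c : ι → ℂ) (t : ι → ℝ),
      (∀ x, 0 ≤ f x) ∧ HasExpSum f S c t ∧ ∑ i ∈ S, ‖c i‖ ≤ 100 * H ^ 2 ∧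
      (∀ i ∈ S, |t i| ≤ 2 * H * q B) ∧
      (∀ T, 2 * T ≤ q A / 2 → ∑ i ∈ S with |t i| < 2 * T, ‖c i‖ ≤
        200 * (H / ((B - A : ℕ) : ℝ)) * (1 - r⁻¹)⁻¹) ∧
      ∀ x, f x < 1 → ∃ n ∈ Finset.Ico A B, distNearestInt (q n * x - δ) < 2 / H := by
  classical
  obtain ⟨a, D, hD, ha, hDpos⟩ := exists_trigPolynomial_minorant hH
  set L := (Finset.Icc (-(H : ℤ)) H).erase 0 with hL
  set G := Finset.Ico A B with hG
  set N : ℝ := ((B - A : ℕ) : ℝ) with hN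
  have hN0 : 0 < N := by
    have : 0 < B - A := by omega
    rw [hN]
    exact_mod_cast this
  have hNc : (N : ℂ) ≠ 0 := by exact_mod_cast hN0.ne'
  have hcardG : (G.card : ℝ) = N := by rw [hG, Nat.card_Ico]
  have hcardL : (L.card : ℝ) = 2 * H := by
    rw [hL, Finset.card_erase_of_mem (by simp), Int.card_Icc]
    have : ((((H : ℤ) + 1 - -(H : ℤ)).toNat - 1 : ℕ)) = 2 * H := by omega
    exact_mod_cast this
  set g : ℝ → ℝ := fun x => 1 - N⁻¹ * ∑ n ∈ G, D (q n * x - δ) with hg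
  set c : ℕ × ℤ → ℂ := fun i => -(N : ℂ)⁻¹ * a i.2 * unitExp (-(i.2 * δ)) with hc
  set t : ℕ × ℤ → ℝ := fun i => i.2 * q i.1 with ht
  have hgsum : HasExpSum g (G ×ˢ L) c t := by
    intro x
    have h1 : ∀ n ∈ G, (D (q n * x - δ) : ℂ) = 1 + ∑ l ∈ L, (a l : ℂ) * unitExp (-(l * δ)) *
        unitExp (l * q n * x) := by
      intro n _
      rw [hD]
      congr 1
      refine Finset.sum_congr rfl fun l _ => ?_
      rw [show (l : ℝ) * (q n * x - δ) = -(l * δ) + l * q n * x by ring, unitExp_add]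
      ring
    simp only [hg, Complex.ofReal_sub, Complex.ofReal_mul, Complex.ofReal_sum, Complex.ofReal_inv,
      Complex.ofReal_one]
    rw [Finset.sum_congr rfl h1, Finset.sum_add_distrib, Finset.sum_const, nsmul_eq_mul, mul_one,
      Finset.sum_product, mul_add,
      show (G.card : ℂ) = N by rw [← hcardG]; push_cast; rfl, inv_mul_cancel₀ hNc,
      sub_add_cancel_left, Finset.mul_sum, ← Finset.sum_neg_distrib]
    refine Finset.sum_congr rfl fun n _ => ?_
    rw [Finset.mul_sum, ← Finset.sum_neg_distrib]
    refine Finset.sum_congr rfl fun l _ => ?_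
    simp only [hc, ht]
    ring
  have hcn : ∀ i, ‖c i‖ ≤ 5 / N := by
    intro i
    simp only [hc, norm_mul, norm_neg, norm_inv, norm_unitExp, mul_one, Complex.norm_real,
      Real.norm_eq_abs, abs_of_pos hN0]
    rw [← div_eq_inv_mul]
    have := ha i.2
    gcongr
  have hqB : ∀ n ∈ G, q n ≤ q B := by
    intro n hn
    rw [hG, Finset.mem_Ico] at hn
    have h1 := pow_mul_le_of_lacunary hr hlac (hA.trans hn.1) hn.2.le
    have h2 : 1 * q n ≤ r ^ (B - n) * q n := by
      have := hq n (hA.trans hn.1)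
      gcongr
      exact one_le_pow₀ hr.le
    linarith
  have htn : ∀ i ∈ G ×ˢ L, |t i| ≤ H * q B := by
    intro i hi
    obtain ⟨h1, h2⟩ := Finset.mem_product.1 hi
    have hqn : 0 < q i.1 := hq _ (hA.trans (Finset.mem_Ico.1 h1).1)
    simp only [ht, abs_mul, abs_of_pos hqn]
    simp only [hL, Finset.mem_erase, Finset.mem_Icc] at h2
    have h3 : |(i.2 : ℝ)| ≤ H := by
      rw [abs_le]
      exact ⟨by exact_mod_cast h2.2.1, by exact_mod_cast h2.2.2⟩
    exact mul_le_mul h3 (hqB _ h1) hqn.le (by positivity)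
  have hcc : ∀ i : (ℕ × ℤ) × (ℕ × ℤ), ‖c i.1 * c i.2‖ ≤ 25 / N ^ 2 := by
    intro i
    rw [norm_mul]
    calc ‖c i.1‖ * ‖c i.2‖ ≤ 5 / N * (5 / N) :=
          mul_le_mul (hcn _) (hcn _) (norm_nonneg _) (by positivity)
      _ = 25 / N ^ 2 := by ring
  refine ⟨fun x => g x * g x, _, _, _, _, fun x => mul_self_nonneg _, hgsum.mul hgsum, ?_, ?_, ?_,
    ?_⟩
  · calc _ ≤ ∑ _i ∈ (G ×ˢ L) ×ˢ (G ×ˢ L), 25 / N ^ 2 := Finset.sum_le_sum fun i _ => hcc i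
      _ = (N * (2 * H)) * (N * (2 * H)) * (25 / N ^ 2) := by
        rw [Finset.sum_const, nsmul_eq_mul]
        simp only [Finset.card_product, Nat.cast_mul, hcardG, hcardL]
      _ = 100 * H ^ 2 := by field_simp; norm_num
  · intro i hi
    obtain ⟨h1, h2⟩ := Finset.mem_product.1 hi
    refine (abs_add_le _ _).trans ?_
    have := htn _ h1
    have := htn _ h2
    linarith
  · intro T hT
    have hcard := card_nearCancellation_le hr hq hlac (B := B) hA (by omega : 1 ≤ H) hT
    calc _ ≤ _ := Finset.sum_le_card_nsmul _ _ _ fun i _ => hcc i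
      _ ≤ (8 * N * H * (1 - r⁻¹)⁻¹) * (25 / N ^ 2) := by
        rw [nsmul_eq_mul]
        exact mul_le_mul_of_nonneg_right hcard (by positivity)
      _ = 200 * (H / N) * (1 - r⁻¹)⁻¹ := by field_simp; norm_num
  · intro x hx
    by_contra! hcon
    have h1 : ∑ n ∈ G, D (q n * x - δ) ≤ 0 := by
      refine Finset.sum_nonpos fun n hn => ?_
      by_contra! hpos
      exact absurd (hDpos _ hpos) (not_lt.2 (hcon n hn))
    have h2 : N⁻¹ * ∑ n ∈ G, D (q n * x - δ) ≤ 0 :=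
      mul_nonpos_of_nonneg_of_nonpos (by positivity) h1
    have h3 : 1 ≤ g x := by simp only [hg]; linarith
    nlinarith

/-! ### Targets missed by many consecutive blocks -/

lemma distNearestInt_sub_intCast (y : ℝ) (k : ℤ) :
    distNearestInt (y - k) = distNearestInt y := by
  simp only [distNearestInt, round_sub_intCast]
  push_cast
  congr 1
  ring

/-- The probability that `δ` is missed by all blocks `3 * 2 ^ j ≤ n < 4 * 2 ^ j` with
`K ≤ j < 2 * K`. The gap between consecutive blocks makes the frequencies of the product of the
earlier test functions small against `q (3 * 2 ^ j)`, so each block contributes a factor `1 / 16`,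
up to an error governed by the bound `ε` for the Fourier transform at high frequencies. -/
lemma measureReal_missed_le {q : ℕ → ℝ} {r : ℝ} (hr : 1 < r) (hq : ∀ n, 1 ≤ n → 0 < q n)
    (hlac : ∀ n, 1 ≤ n → r * q n ≤ q (n + 1)) {a K : ℕ}
    (ha : 200 * (1 / 2 ^ a) * (1 - r⁻¹)⁻¹ ≤ 1 / 16) (hK : a + 1 ≤ K)
    (hgap : ∀ j, K ≤ j → 1 / 4 + 2 * 2 ^ j ≤ r ^ 2 ^ (j + 1) / 4)
    (μ : Measure ℝ) [IsProbabilityMeasure μ] {ε : ℝ} (hε0 : 0 ≤ ε)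
    (hε : ∀ u, q (3 * 2 ^ K) / 4 ≤ |u| → ‖∫ x, unitExp (u * x) ∂μ‖ ≤ ε) (δ : ℝ) :
    μ.real {x | ∀ j ∈ Finset.Ico K (2 * K), ∀ n ∈ Finset.Ico (3 * 2 ^ j) (4 * 2 ^ j),
      2 / ((2 ^ (j - a) : ℕ) : ℝ) ≤ distNearestInt (q n * x - δ)} ≤
      (1 / 16) ^ K + K * ((100 * 16 ^ K) ^ K * ε) := by
  have hblock := fun j (hj : a + 1 ≤ j) => exists_blockTest hr hq hlac
    (A := 3 * 2 ^ j) (B := 4 * 2 ^ j) (H := 2 ^ (j - a))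
    (by have := Nat.pos_of_ne_zero (pow_ne_zero j (two_ne_zero (α := ℕ))); omega)
    (by have := Nat.pos_of_ne_zero (pow_ne_zero j (two_ne_zero (α := ℕ))); omega)
    (by calc 2 = 2 ^ 1 := by norm_num
          _ ≤ 2 ^ (j - a) := Nat.pow_le_pow_right (by norm_num) (by omega)) δ
  choose f ι S c t hf0 hfsum hfW hfT hfs hf1 using fun m : ℕ => hblock (K + m) (by omega)
  set W : ℝ := 100 * 16 ^ K with hWdef
  have hW1 : 1 ≤ W := by
    have : (1 : ℝ) ≤ 16 ^ K := one_le_pow₀ (by norm_num)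
    rw [hWdef]
    linarith
  have hH : ∀ m, ((2 ^ (K + m - a) : ℕ) : ℝ) ≤ 2 ^ (K + m) := by
    intro m
    push_cast
    exact pow_le_pow_right₀ (by norm_num) (by omega)
  have hweight : ∀ m < K, ∑ i ∈ S m, ‖c m i‖ ≤ W := by
    intro m hm
    refine (hfW m).trans ?_
    calc 100 * ((2 ^ (K + m - a) : ℕ) : ℝ) ^ 2 ≤ 100 * (2 ^ (K + m)) ^ 2 := by
          have := hH m
          gcongr
      _ ≤ 100 * (2 ^ (2 * K)) ^ 2 := by
          gcongr
          · norm_num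
          · omega
      _ = W := by
          rw [hWdef, ← pow_mul, show (16 : ℝ) = 2 ^ 4 by norm_num, ← pow_mul]
          congr 2
          ring
  have hlowfreq : ∀ m, ∑ i ∈ S m with |t m i| < 2 * (q (3 * 2 ^ (K + m)) / 4), ‖c m i‖
      ≤ 1 / 16 := by
    intro m
    refine (hfs m _ (by linarith)).trans (le_trans (le_of_eq ?_) ha)
    have h1 : (4 * 2 ^ (K + m) - 3 * 2 ^ (K + m) : ℕ) = 2 ^ (K + m - a) * 2 ^ a := by
      rw [← pow_add, Nat.sub_add_cancel (by omega)]
      omega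
    rw [h1]
    push_cast
    field_simp
  -- The product of the test functions up to one block still has frequencies at most a quarter of
  -- the smallest `q n` of the next block.
  have hstep : ∀ m, q (3 * 2 ^ (K + m)) / 4 + 2 * ((2 ^ (K + m - a) : ℕ) : ℝ) *
      q (4 * 2 ^ (K + m)) ≤ q (3 * 2 ^ (K + (m + 1))) / 4 := by
    intro m
    have hpos : 1 ≤ 2 ^ (K + m) := Nat.one_le_two_pow
    have e1 := pow_mul_le_of_lacunary hr hlac (m := 4 * 2 ^ (K + m)) (n := 3 * 2 ^ (K + (m + 1)))
      (by omega) (by rw [← add_assoc, pow_succ]; omega)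
    have e2 : 3 * 2 ^ (K + (m + 1)) - 4 * 2 ^ (K + m) = 2 ^ (K + m + 1) := by
      rw [← add_assoc, pow_succ]
      omega
    rw [e2] at e1
    have e3 := pow_mul_le_of_lacunary hr hlac (m := 3 * 2 ^ (K + m)) (n := 4 * 2 ^ (K + m))
      (by omega) (by omega)
    have hqp : 0 < q (3 * 2 ^ (K + m)) := hq _ (by omega)
    have hqp' : 0 < q (4 * 2 ^ (K + m)) := hq _ (by omega)
    have e4 : 1 * q (3 * 2 ^ (K + m)) ≤ r ^ (4 * 2 ^ (K + m) - 3 * 2 ^ (K + m)) *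
        q (3 * 2 ^ (K + m)) := by
      gcongr
      exact one_le_pow₀ hr.le
    have e5 := mul_le_mul_of_nonneg_right (hgap (K + m) (by omega)) hqp'.le
    have e6 : 2 * ((2 ^ (K + m - a) : ℕ) : ℝ) * q (4 * 2 ^ (K + m)) ≤
        2 * 2 ^ (K + m) * q (4 * 2 ^ (K + m)) := by
      have := hH m
      gcongr
    linarith
  have hfreq_mono : ∀ m, q (3 * 2 ^ K) / 4 ≤ q (3 * 2 ^ (K + m)) / 4 := by
    intro m
    induction m with
    | zero => simp
    | succ m ih =>
      have hpos : 1 ≤ 2 ^ (K + m) := Nat.one_le_two_pow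
      have hqp' : 0 < q (4 * 2 ^ (K + m)) := hq _ (by omega)
      have : 0 ≤ 2 * ((2 ^ (K + m - a) : ℕ) : ℝ) * q (4 * 2 ^ (K + m)) := by positivity
      linarith [hstep m]
  -- The product of the test functions of the first `m` blocks, and its three inductive bounds.
  set P : ℕ → ℝ → ℝ := fun m x => ∏ i ∈ Finset.range m, f i x with hP
  have hP0 : ∀ m x, 0 ≤ P m x := fun m x => Finset.prod_nonneg fun i _ => hf0 i x
  have hPsucc : ∀ m, P (m + 1) = fun x => P m x * f m x := by
    intro m
    ext x
    simp only [hP, Finset.prod_range_succ]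
  have hPsum : ∀ m ≤ K, IsExpSum (P m) (W ^ m) (q (3 * 2 ^ (K + m)) / 4) := by
    intro m hm
    induction m with
    | zero =>
      have hP_zero : P 0 = fun _ => 1 := by ext x; simp [hP]
      rw [hP_zero, pow_zero]
      refine isExpSum_one.mono le_rfl ?_
      have hpos : 1 ≤ 2 ^ (K + 0) := Nat.one_le_two_pow
      have := hq (3 * 2 ^ (K + 0)) (by omega)
      linarith
    | succ m ih =>
      rw [hPsucc]
      have hfm : IsExpSum (f m) W (2 * ((2 ^ (K + m - a) : ℕ) : ℝ) * q (4 * 2 ^ (K + m))) :=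
        ⟨ι m, S m, c m, t m, hfsum m, hweight m (by omega), hfT m⟩
      exact ((ih (by omega)).mul hfm).mono (pow_succ W m).symm.le (hstep m)
  have hint : ∀ m ≤ K, ∫ x, P m x ∂μ ≤ (1 / 16) ^ m + m * (W ^ K * ε) := by
    intro m hm
    induction m with
    | zero => simp [hP]
    | succ m ih =>
      rw [hPsucc]
      have h1 := integral_mul_expSum_le (hPsum m (by omega)) (hP0 m) (hfsum m)
        (hweight m (by omega)) (hlowfreq m) (fun u hu => hε u ((hfreq_mono m).trans hu)) hε0
      have h2 := ih (by omega)
      have h3 : W ^ m * W ≤ W ^ K := by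
        rw [← pow_succ]
        exact pow_le_pow_right₀ hW1 hm
      have h4 : W ^ m * W * ε ≤ W ^ K * ε := mul_le_mul_of_nonneg_right h3 hε0
      have h5 : 0 ≤ (m : ℝ) * (W ^ K * ε) := by positivity
      calc _ ≤ _ := h1
        _ ≤ 1 / 16 * ((1 / 16) ^ m + m * (W ^ K * ε)) + W ^ K * ε := by gcongr
        _ ≤ (1 / 16) ^ (m + 1) + ((m + 1 : ℕ) : ℝ) * (W ^ K * ε) := by
          rw [pow_succ]
          push_cast
          linarith
  have hmarkov := mul_meas_ge_le_integral_of_nonneg (ae_of_all μ (hP0 K))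
    ((hPsum K le_rfl).integrable μ) 1
  rw [one_mul] at hmarkov
  refine (measureReal_mono ?_).trans (hmarkov.trans (hint K le_rfl))
  intro x hx
  simp only [Set.mem_ofPred_eq] at hx ⊢
  refine Finset.one_le_prod fun m hm => ?_
  by_contra! hlt
  obtain ⟨n, hn, hdist⟩ := hf1 m x hlt
  rw [Finset.mem_range] at hm
  exact absurd hdist (not_lt.2 (hx (K + m) (Finset.mem_Ico.2 ⟨by omega, by omega⟩) n hn))

lemma eventually_mul_sq_le_two_pow (M : ℕ) : ∀ᶠ K : ℕ in atTop, M * K ^ 2 ≤ 2 ^ K := by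
  have h := tendsto_pow_const_div_const_pow_of_one_lt 2 (one_lt_two (α := ℝ))
  have hM : (0 : ℝ) < 1 / (M + 1) := by positivity
  filter_upwards [h.eventually (gt_mem_nhds hM)] with K hK
  rw [div_lt_div_iff₀ (by positivity) (by positivity)] at hK
  have h0 : (0 : ℝ) ≤ (K : ℝ) ^ 2 := by positivity
  have : ((M * K ^ 2 : ℕ) : ℝ) ≤ ((2 ^ K : ℕ) : ℝ) := by
    push_cast
    linarith
  exact_mod_cast this

/-- Doubly exponential decay beats the weight `(100 * 16 ^ K) ^ K` of a product of `K` blocks and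
the number `4 ^ K` of targets. -/
lemma eventually_weight_mul_pow_le {θ : ℝ} (h0 : 0 ≤ θ) (h1 : θ < 1) :
    ∀ᶠ K : ℕ in atTop, 4 ^ K * (K * ((100 * 16 ^ K) ^ K * θ ^ 2 ^ K)) ≤ (1 / 2) ^ K := by
  obtain ⟨M, hM⟩ := exists_pow_lt_of_lt_one (by norm_num : (0 : ℝ) < 1 / 2) h1
  filter_upwards [eventually_mul_sq_le_two_pow (M * 15), eventually_ge_atTop 1] with K hK hK1
  have hθ : θ ^ 2 ^ K ≤ (1 / 2) ^ (15 * K ^ 2) := by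
    calc θ ^ 2 ^ K ≤ θ ^ (M * 15 * K ^ 2) := pow_le_pow_of_le_one h0 h1.le hK
      _ = (θ ^ M) ^ (15 * K ^ 2) := by rw [← pow_mul, mul_assoc]
      _ ≤ (1 / 2) ^ (15 * K ^ 2) := by gcongr
  have hKle : (K : ℝ) ≤ 2 ^ K := by exact_mod_cast Nat.lt_two_pow_self.le
  -- `7 * K` and `4 * K * K` come from `100 ≤ 2 ^ 7` and `16 = 2 ^ 4`; the last `K` is the gain.
  have hexp : 2 * K + (K + (7 * K + 4 * K * K)) + K ≤ 15 * K ^ 2 := by nlinarith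
  calc (4 : ℝ) ^ K * (K * ((100 * 16 ^ K) ^ K * θ ^ 2 ^ K))
      ≤ 4 ^ K * (2 ^ K * ((2 ^ 7 * 16 ^ K) ^ K * (1 / 2) ^ (15 * K ^ 2))) := by
        gcongr
        norm_num
    _ = 2 ^ (2 * K + (K + (7 * K + 4 * K * K)) + K) * (1 / 2) ^ (15 * K ^ 2) * (1 / 2) ^ K := by
        rw [show (4 : ℝ) = 2 ^ 2 by norm_num, show (16 : ℝ) = 2 ^ 4 by norm_num, mul_pow]
        simp only [← pow_mul]
        simp only [pow_add]
        field_simp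
        simp only [← mul_pow]
        norm_num
    _ ≤ 2 ^ (15 * K ^ 2) * (1 / 2) ^ (15 * K ^ 2) * (1 / 2) ^ K := by
        gcongr
        norm_num
    _ = (1 / 2) ^ K := by
        rw [← mul_pow]
        norm_num

lemma eventually_gap_le {r : ℝ} (hr : 1 < r) :
    ∀ᶠ K : ℕ in atTop, ∀ j, K ≤ j → 1 / 4 + 2 * 2 ^ j ≤ r ^ 2 ^ (j + 1) / 4 := by
  have hr0 : 0 < r := by linarith
  have h := tendsto_pow_const_div_const_pow_of_one_lt 1 hr
  have h2 : Tendsto (fun j : ℕ => 2 ^ (j + 1)) atTop atTop :=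
    (tendsto_pow_atTop_atTop_of_one_lt (by norm_num : 1 < 2)).comp (tendsto_add_atTop_nat 1)
  have h3 := h2.eventually (h.eventually (gt_mem_nhds (by norm_num : (0 : ℝ) < 1 / 8)))
  refine (eventually_forall_ge_atTop.2 (h3)).mono fun K hK j hj => ?_
  have h4 := hK j hj
  rw [pow_one, div_lt_div_iff₀ (by positivity) (by norm_num)] at h4
  push_cast at h4
  have h5 : (1 : ℝ) ≤ 2 ^ j := one_le_pow₀ (by norm_num)
  rw [pow_succ] at h4
  nlinarith

/-! ### Approximation of all targets almost everywhere -/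

lemma fourierTransformMeasure_eq_integral {μ : Measure ℝ} [IsProbabilityMeasure μ]
    (hμ : μ (Set.Ico (0 : ℝ) 1) = 1) (t : ℝ) :
    fourierTransformMeasure μ t = ∫ x, unitExp (t * x) ∂μ := by
  have hae : ∀ᵐ x ∂μ, x ∈ Set.Ico (0 : ℝ) 1 :=
    (prob_compl_eq_zero_iff measurableSet_Ico).2 hμ
  rw [fourierTransformMeasure, Measure.restrict_eq_self_of_ae_mem hae]
  rfl

lemma exists_norm_fourier_le {μ : Measure ℝ} [IsProbabilityMeasure μ]
    (hμ : μ (Set.Ico (0 : ℝ) 1) = 1) {η : ℝ} (hη : 0 < η)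
    (hO : (fourierTransformMeasure μ) =O[cocompact ℝ] (fun t : ℝ => 1 / (1 + |t|) ^ η)) :
    ∃ c T₀ : ℝ, 0 ≤ c ∧ ∀ T, 0 < T → T₀ ≤ T → ∀ u, T ≤ |u| →
      ‖∫ x, unitExp (u * x) ∂μ‖ ≤ c * T ^ (-η) := by
  obtain ⟨c, hc0, hc⟩ := hO.exists_nonneg
  rw [isBigOWith_iff, ← Metric.cobounded_eq_cocompact,
    (hasBasis_cobounded_norm (E := ℝ)).eventually_iff] at hc
  obtain ⟨T₀, -, hT₀⟩ := hc
  refine ⟨c, T₀, hc0, fun T hT hT' u hu => ?_⟩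
  have h := hT₀ (x := u) (hT'.trans hu)
  rw [fourierTransformMeasure_eq_integral hμ] at h
  refine h.trans (mul_le_mul_of_nonneg_left ?_ hc0)
  have hu0 : 0 ≤ |u| := abs_nonneg u
  rw [Real.norm_of_nonneg (by positivity), one_div, ← Real.rpow_neg (by positivity)]
  exact Real.rpow_le_rpow_of_nonpos hT (by linarith) (by linarith)

/-- Only finitely many dyadic scales `K` fail to approximate every target `i / 4 ^ K` by some
`q n * x` with `3 * 2 ^ K ≤ n < 2 * 4 ^ K`, to the precision of the block containing `n`. -/
lemma ae_eventually_forall_grid {q : ℕ → ℝ} {r : ℝ} (hr : 1 < r) (hq : ∀ n, 1 ≤ n → 0 < q n)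
    (hlac : ∀ n, 1 ≤ n → r * q n ≤ q (n + 1)) {a : ℕ}
    (ha : 200 * (1 / 2 ^ a) * (1 - r⁻¹)⁻¹ ≤ 1 / 16) {μ : Measure ℝ} [IsProbabilityMeasure μ]
    (hμ : μ (Set.Ico (0 : ℝ) 1) = 1) {η : ℝ} (hη : 0 < η)
    (hO : (fourierTransformMeasure μ) =O[cocompact ℝ] (fun t : ℝ => 1 / (1 + |t|) ^ η)) :
    ∀ᵐ x ∂μ, ∀ᶠ K : ℕ in atTop, ∀ i ∈ Finset.range (4 ^ K), ∃ j ∈ Finset.Ico K (2 * K),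
      ∃ n ∈ Finset.Ico (3 * 2 ^ j) (4 * 2 ^ j),
        distNearestInt (q n * x - (i : ℝ) / 4 ^ K) < 2 / ((2 ^ (j - a) : ℕ) : ℝ) := by
  obtain ⟨c, T₀, hc0, hc⟩ := exists_norm_fourier_le hμ hη hO
  have hr0 : 0 < r := by linarith
  have hq1 : 0 < q 1 := hq 1 le_rfl
  set θ : ℝ := r ^ (-η) with hθ
  have hθ0 : 0 < θ := Real.rpow_pos_of_pos hr0 _
  have hθ1 : θ < 1 := Real.rpow_lt_one_of_one_lt_of_neg hr (by linarith)
  set c' : ℝ := c * (q 1 / 4) ^ (-η) with hc'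
  have hc'0 : 0 ≤ c' := by positivity
  have hgrow : ∀ K : ℕ, r ^ 2 ^ K * (q 1 / 4) ≤ q (3 * 2 ^ K) / 4 := by
    intro K
    have hpos : 1 ≤ 2 ^ K := Nat.one_le_two_pow
    have h1 := pow_mul_le_of_lacunary hr hlac (m := 1) (n := 3 * 2 ^ K) le_rfl (by omega)
    have h2 : r ^ 2 ^ K * q 1 ≤ r ^ (3 * 2 ^ K - 1) * q 1 := by
      gcongr
      · exact hr.le
      · omega
    linarith
  set bad : ℕ → ℕ → Set ℝ := fun K i => {x | ∀ j ∈ Finset.Ico K (2 * K),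
    ∀ n ∈ Finset.Ico (3 * 2 ^ j) (4 * 2 ^ j),
      2 / ((2 ^ (j - a) : ℕ) : ℝ) ≤ distNearestInt (q n * x - (i : ℝ) / 4 ^ K)} with hbad
  have hlarge : ∀ᶠ K : ℕ in atTop, T₀ ≤ r ^ 2 ^ K * (q 1 / 4) := by
    have h2 : Tendsto (fun K : ℕ => 2 ^ K) atTop atTop :=
      tendsto_pow_atTop_atTop_of_one_lt (by norm_num : 1 < 2)
    exact (((tendsto_pow_atTop_atTop_of_one_lt hr).comp h2).atTop_mul_const
      (by positivity)).eventually_ge_atTop T₀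
  have hmeas : ∀ᶠ K : ℕ in atTop,
      μ (⋃ i ∈ Finset.range (4 ^ K), bad K i) ≤ ENNReal.ofReal ((1 + c') * (1 / 2) ^ K) := by
    filter_upwards [hlarge, eventually_gap_le hr, eventually_weight_mul_pow_le hθ0.le hθ1,
      eventually_ge_atTop (a + 1)] with K hT hgap hweight hK
    have hbound : ∀ i, μ.real (bad K i) ≤
        (1 / 16) ^ K + K * ((100 * 16 ^ K) ^ K * (c' * θ ^ 2 ^ K)) := by
      intro i
      refine measureReal_missed_le hr hq hlac ha hK hgap μ (by positivity) (fun u hu => ?_) _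
      have hTpos : 0 < r ^ 2 ^ K * (q 1 / 4) := by positivity
      refine (hc _ hTpos hT u ((hgrow K).trans hu)).trans (le_of_eq ?_)
      rw [Real.mul_rpow (by positivity) (by positivity), hc', hθ, ← Real.rpow_natCast,
        ← Real.rpow_natCast, ← Real.rpow_mul hr0.le, ← Real.rpow_mul hr0.le,
        mul_comm (-η)]
      ring
    have hunion : μ.real (⋃ i ∈ Finset.range (4 ^ K), bad K i) ≤ (1 + c') * (1 / 2) ^ K := by
      calc μ.real (⋃ i ∈ Finset.range (4 ^ K), bad K i)
          ≤ ∑ i ∈ Finset.range (4 ^ K), μ.real (bad K i) := measureReal_biUnion_finset_le _ _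
        _ ≤ ∑ i ∈ Finset.range (4 ^ K),
            ((1 / 16) ^ K + K * ((100 * 16 ^ K) ^ K * (c' * θ ^ 2 ^ K))) :=
          Finset.sum_le_sum fun i _ => hbound i
        _ = (4 * (1 / 16)) ^ K + c' * (4 ^ K * (K * ((100 * 16 ^ K) ^ K * θ ^ 2 ^ K))) := by
          rw [Finset.sum_const, Finset.card_range, nsmul_eq_mul, mul_pow (4 : ℝ) (1 / 16)]
          push_cast
          ring
        _ ≤ (1 / 2) ^ K + c' * (1 / 2) ^ K := by
          gcongr
          norm_num
        _ = (1 + c') * (1 / 2) ^ K := by ring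
    rw [← ENNReal.ofReal_toReal (measure_ne_top μ (⋃ i ∈ Finset.range (4 ^ K), bad K i))]
    exact ENNReal.ofReal_le_ofReal hunion
  obtain ⟨K₀, hK₀⟩ := eventually_atTop.1 hmeas
  have hsummable : Summable fun K : ℕ => (1 + c') * (1 / 2 : ℝ) ^ (K + K₀) :=
    ((summable_nat_add_iff K₀).2 (summable_geometric_two)).mul_left _
  have htsum : ∑' K, μ (⋃ i ∈ Finset.range (4 ^ (K + K₀)), bad (K + K₀) i) ≠ ⊤ :=
    ne_top_of_le_ne_top hsummable.tsum_ofReal_ne_top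
      (ENNReal.tsum_le_tsum fun K => hK₀ _ (by omega))
  filter_upwards [ae_eventually_notMem htsum] with x hx
  obtain ⟨K₁, hK₁⟩ := eventually_atTop.1 hx
  filter_upwards [eventually_ge_atTop (K₁ + K₀)] with K hK i hi
  have hmem := hK₁ (K - K₀) (by omega)
  rw [Nat.sub_add_cancel (by omega)] at hmem
  by_contra! hcon
  exact hmem (Set.mem_biUnion hi hcon)

lemma exists_two_pow_constant (R : ℝ) : ∃ a : ℕ, 200 * (1 / 2 ^ a) * R ≤ 1 / 16 := by
  obtain ⟨a, ha⟩ := pow_unbounded_of_one_lt (3200 * R) (one_lt_two (α := ℝ))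
  refine ⟨a, ?_⟩
  have h2 : (0 : ℝ) < 2 ^ a := by positivity
  rw [mul_one_div, div_mul_eq_mul_div, div_le_div_iff₀ h2 (by norm_num)]
  linarith

/-- The case of positive sequences. Targets range over all of `ℝ`, so that a negative sequence can
be reduced to this case by changing the sign of `δ`. -/
lemma exists_uniform_approximation_of_pos {q : ℕ → ℝ} {r : ℝ} (hr : 1 < r)
    (hq : ∀ n, 1 ≤ n → 0 < q n) (hlac : ∀ n, 1 ≤ n → r * q n ≤ q (n + 1)) :
    ∃ C : ℝ, 0 < C ∧
      ∀ (μ : Measure ℝ) [IsProbabilityMeasure μ], μ (Set.Ico (0 : ℝ) 1) = 1 →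
        ∀ η : ℝ, 0 < η →
          (fourierTransformMeasure μ) =O[cocompact ℝ] (fun t : ℝ => 1 / (1 + |t|) ^ η) →
          ∀ᵐ x ∂μ, ∀ δ : ℝ,
            {n : ℕ | 1 ≤ n ∧ distNearestInt (q n * x - δ) < C / n}.Infinite := by
  obtain ⟨a, ha⟩ := exists_two_pow_constant (1 - r⁻¹)⁻¹
  refine ⟨4 * (2 * 2 ^ a + 1), by positivity, fun μ _ hμ η hη hO => ?_⟩
  filter_upwards [ae_eventually_forall_grid hr hq hlac ha hμ hη hO] with x hx δ
  refine Set.infinite_of_forall_exists_gt fun m => ?_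
  obtain ⟨K, hK, hmK, haK⟩ :=
    (hx.and ((eventually_ge_atTop m).and (eventually_ge_atTop a))).exists
  have h4 : (0 : ℝ) < 4 ^ K := by positivity
  have hδ0 : 0 ≤ Int.fract δ * 4 ^ K := mul_nonneg (Int.fract_nonneg δ) h4.le
  set i := ⌊Int.fract δ * 4 ^ K⌋₊ with hi
  have hi_lt : i < 4 ^ K := by
    rw [hi, Nat.floor_lt hδ0]
    push_cast
    have := Int.fract_lt_one δ
    nlinarith
  obtain ⟨j, hj, n, hn, hdist⟩ := hK i (Finset.mem_range.2 hi_lt)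
  rw [Finset.mem_Ico] at hj hn
  have hj2 : 1 ≤ 2 ^ j := Nat.one_le_two_pow
  have hKj : K < 2 ^ j := hj.1.trans_lt Nat.lt_two_pow_self
  refine ⟨n, ⟨by omega, ?_⟩, by omega⟩
  have hgrid : |(i : ℝ) / 4 ^ K - Int.fract δ| ≤ 1 / 4 ^ K := by
    have e1 := Nat.floor_le hδ0
    have e2 := Nat.lt_floor_add_one (Int.fract δ * 4 ^ K)
    rw [← hi] at e1 e2
    have e3 : (i : ℝ) / 4 ^ K - Int.fract δ = (i - Int.fract δ * 4 ^ K) / 4 ^ K := by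
      field_simp
    rw [e3, abs_div, abs_of_pos h4]
    gcongr
    rw [abs_le]
    constructor <;> linarith
  have hpow : (1 : ℝ) / 4 ^ K ≤ 1 / 2 ^ j := by
    rw [show (4 : ℝ) = 2 ^ 2 by norm_num, ← pow_mul]
    gcongr
    · norm_num
    · omega
  have hH : (2 : ℝ) / ((2 ^ (j - a) : ℕ) : ℝ) = 2 * 2 ^ a / 2 ^ j := by
    have : (2 : ℝ) ^ j = 2 ^ (j - a) * 2 ^ a := by
      rw [← pow_add, Nat.sub_add_cancel (by omega)]
    rw [this]
    push_cast
    field_simp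
  have hn_pos : (0 : ℝ) < n := by
    have : 0 < n := by omega
    exact_mod_cast this
  have hn_le : (n : ℝ) ≤ 4 * 2 ^ j := by exact_mod_cast hn.2.le
  have hfract : q n * x - δ =
      (q n * x - i / 4 ^ K + (i / 4 ^ K - Int.fract δ)) - (⌊δ⌋ : ℤ) := by
    have := Int.floor_add_fract δ
    linarith
  calc distNearestInt (q n * x - δ)
      ≤ distNearestInt (q n * x - i / 4 ^ K) + |(i : ℝ) / 4 ^ K - Int.fract δ| := by
        rw [hfract, distNearestInt_sub_intCast]
        exact distNearestInt_add_le _ _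
    _ < 2 * 2 ^ a / 2 ^ j + 1 / 2 ^ j := by
        rw [← hH]
        exact add_lt_add_of_lt_of_le hdist (hgrid.trans hpow)
    _ = 4 * (2 * 2 ^ a + 1) / (4 * 2 ^ j) := by field_simp
    _ ≤ 4 * (2 * 2 ^ a + 1) / n := by gcongr

lemma pos_of_lacunary {q : ℕ → ℝ} {r : ℝ} (hr : 1 < r) (h : ∀ n, 1 ≤ n → r ≤ q (n + 1) / q n)
    (h1 : 0 < q 1) : ∀ n, 1 ≤ n → 0 < q n := by
  intro n hn
  induction n, hn using Nat.le_induction with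
  | base => exact h1
  | succ n hn ih =>
    have : 0 < q (n + 1) / q n := by linarith [h n hn]
    exact (div_pos_iff_of_pos_right ih).1 this

theorem theorem1 (q : ℕ → ℝ) (hq : IsLacunary q) :
    ∃ C : ℝ, 0 < C ∧
      ∀ (μ : Measure ℝ) [IsProbabilityMeasure μ], μ (Set.Ico (0 : ℝ) 1) = 1 →
        ∀ η : ℝ, 0 < η →
          (fourierTransformMeasure μ) =O[cocompact ℝ] (fun t : ℝ => 1 / (1 + |t|) ^ η) →
          ∀ᵐ x ∂μ, ∀ δ ∈ Set.Ico (0 : ℝ) 1,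
            {n : ℕ | 1 ≤ n ∧ distNearestInt (q n * x - δ) < C / n}.Infinite := by
  obtain ⟨r, hr, hlac⟩ := hq
  rcases lt_trichotomy (q 1) 0 with h1 | h1 | h1
  · have hlac' : ∀ n, 1 ≤ n → r ≤ (-q (n + 1)) / (-q n) := by
      intro n hn
      rw [neg_div_neg_eq]
      exact hlac n hn
    have hpos := pos_of_lacunary (q := fun n => -q n) hr hlac' (neg_pos.2 h1)
    obtain ⟨C, hC, h⟩ := exists_uniform_approximation_of_pos hr hpos fun n hn =>
      (le_div_iff₀ (hpos n hn)).1 (hlac' n hn)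
    refine ⟨C, hC, fun μ _ hμ η hη hO => ?_⟩
    filter_upwards [h μ hμ η hη hO] with x hx δ _
    convert hx (-δ) using 5 with n
    rw [← distNearestInt_neg]
    congr 1
    ring
  · have := hlac 1 le_rfl
    rw [h1, div_zero] at this
    linarith
  · have hpos := pos_of_lacunary hr hlac h1
    obtain ⟨C, hC, h⟩ := exists_uniform_approximation_of_pos hr hpos fun n hn =>
      (le_div_iff₀ (hpos n hn)).1 (hlac n hn)
    refine ⟨C, hC, fun μ _ hμ η hη hO => ?_⟩
    filter_upwards [h μ hμ η hη hO] with x hx δ _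
    exact hx δ
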